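/- Let $G=(V,E)$ be a finite simple graph. For $a\in V$ write $N_G[a]=\{a\}\cup\{u\in V : ua\in E\}$. For $B\subseteq V$ let $\gamma(B,G)$ be the minimum size of a set $A\subseteq V$ that dominates $B$, i.e. with $B\subseteq\bigcup_{a\in A}N_G[a]$. Let $\gamma(G)=\gamma(V,G)$ be the domination number of $G$, and let the independence domination number $\gamma^i(G)$ be the maximum of $\gamma(I,G)$ over all independent sets $I$ of $G$. A biclique of $G$ is a (not necessarily induced) subgraph of $G$ that is isomorphic to a complete bipartite graph $K_{p,q}$ with $p,q\ge 1$, or that consists of a single vertex. Let the biclique vertex partition number $\operatorname{bp}(G)$ be the least integer $k\ge 0$ for which there are $k$ bicliques of $G$ such that every vertex of $G$ belongs to exactly one of them. Then $$\gamma^i(G)\;\le\;\operatorname{bp}(G)\;\le\;\gamma(G).$$ -/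

import Mathlib

namespace SimpleGraph

variable {V : Type*}

/-- The closed neighbourhood `N_G[a] = N_G(a) ∪ {a}`. -/
def closedNbhd (G : SimpleGraph V) (a : V) : Set V :=
  G.neighborSet a ∪ {a}

/-- `A` dominates `B` if `B ⊆ ⋃_{a ∈ A} N_G[a]`. -/
def Dominates (G : SimpleGraph V) (A B : Set V) : Prop :=
  B ⊆ ⋃ a ∈ A, G.closedNbhd a

/-- `γ(B, G)`: the minimum size of a (finite) set of vertices dominating `B`. -/
noncomputable def domNumberOf (G : SimpleGraph V) (B : Set V) : ℕ :=
  sInf {k : ℕ | ∃ A : Finset V, G.Dominates (A : Set V) B ∧ A.card = k}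

/-- The domination number `γ(G) = γ(V, G)`. -/
noncomputable def domNumber (G : SimpleGraph V) : ℕ :=
  G.domNumberOf Set.univ

/-- The independence domination number `γ^i(G)`: the maximum of `γ(I, G)` over all independent
sets `I` of `G`. -/
noncomputable def indepDomNumber (G : SimpleGraph V) : ℕ :=
  sSup {k : ℕ | ∃ I : Set V, G.IsIndepSet I ∧ G.domNumberOf I = k}

/-- A biclique of `G`: a (not necessarily induced) subgraph isomorphic to a complete bipartite
graph `K_{p,q}` with `p, q ≥ 1`, or consisting of a single vertex (`K_{1,0}`, the trivial star;
without it a graph with isolated vertices would have no partition into bicliques). -/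
def IsBiclique (G : SimpleGraph V) (H : G.Subgraph) : Prop :=
  (∃ p q : ℕ, 1 ≤ p ∧ 1 ≤ q ∧ Nonempty (H.coe ≃g completeBipartiteGraph (Fin p) (Fin q))) ∨
    ∃ v : V, H = G.singletonSubgraph v

/-- A biclique vertex partition of `G`: a finite set of bicliques such that every vertex of `G`
belongs to exactly one of them. -/
def IsBicliqueVertexPartition (G : SimpleGraph V) (R : Finset G.Subgraph) : Prop :=
  (∀ H ∈ R, G.IsBiclique H) ∧ ∀ v : V, ∃! H : G.Subgraph, H ∈ R ∧ v ∈ H.verts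

/-- The biclique vertex partition number `bp(G)`: the least `k` such that `G` has a biclique vertex
partition of size `k`. -/
noncomputable def bicliquePartitionNumber (G : SimpleGraph V) : ℕ :=
  sInf {k : ℕ | ∃ R : Finset G.Subgraph, G.IsBicliqueVertexPartition R ∧ R.card = k}

/-! The minima and the maximum above are attained when the graph is finite. -/

theorem domNumberOf_isLeast [Finite V] (G : SimpleGraph V) (B : Set V) :
    IsLeast {k : ℕ | ∃ A : Finset V, G.Dominates (A : Set V) B ∧ A.card = k}
      (G.domNumberOf B) := by
  have hne : {k : ℕ | ∃ A : Finset V, G.Dominates (A : Set V) B ∧ A.card = k}.Nonempty := by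
    have := Fintype.ofFinite V
    refine ⟨_, Finset.univ, ?_, rfl⟩
    intro x _
    simp only [Set.mem_iUnion]
    exact ⟨x, by simp, Or.inr rfl⟩
  exact ⟨Nat.sInf_mem hne, fun k hk => Nat.sInf_le hk⟩

theorem indepDomNumber_isGreatest [Finite V] (G : SimpleGraph V) :
    IsGreatest {k : ℕ | ∃ I : Set V, G.IsIndepSet I ∧ G.domNumberOf I = k}
      G.indepDomNumber := by
  have hfin : {k : ℕ | ∃ I : Set V, G.IsIndepSet I ∧ G.domNumberOf I = k}.Finite :=
    (Set.finite_range G.domNumberOf).subset (by rintro k ⟨I, _, rfl⟩; exact ⟨I, rfl⟩)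
  have hne : {k : ℕ | ∃ I : Set V, G.IsIndepSet I ∧ G.domNumberOf I = k}.Nonempty :=
    ⟨_, ∅, by simp [IsIndepSet], rfl⟩
  exact ⟨Nat.sSup_mem hne hfin.bddAbove, fun k hk => le_csSup hfin.bddAbove hk⟩

theorem bicliquePartitionNumber_isLeast [Finite V] (G : SimpleGraph V) :
    IsLeast {k : ℕ | ∃ R : Finset G.Subgraph, G.IsBicliqueVertexPartition R ∧ R.card = k}
      G.bicliquePartitionNumber := by
  classical
  have hne : {k : ℕ | ∃ R : Finset G.Subgraph,
      G.IsBicliqueVertexPartition R ∧ R.card = k}.Nonempty := by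
    have := Fintype.ofFinite V
    refine ⟨_, Finset.univ.image G.singletonSubgraph, ⟨?_, ?_⟩, rfl⟩
    · intro H hH
      obtain ⟨v, _, rfl⟩ := Finset.mem_image.1 hH
      exact Or.inr ⟨v, rfl⟩
    · intro v
      refine ⟨G.singletonSubgraph v, ⟨by simp, by simp⟩, ?_⟩
      rintro H ⟨hH, hv⟩
      obtain ⟨w, _, rfl⟩ := Finset.mem_image.1 hH
      have : v = w := by simpa using hv
      rw [this]
  exact ⟨Nat.sInf_mem hne, fun k hk => Nat.sInf_le hk⟩

end SimpleGraph

namespace SimpleGraph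

variable {V : Type*}

/-! Lower bound: an independent set `I` meets at most one side of a biclique, so any vertex of the
other side dominates its part of `I` there (`IsBiclique.exists_dominates`). One such vertex per
biclique of a minimum partition dominates `I`. Upper bound: send each vertex to a dominator in a
minimum dominating set `A`, with the elements of `A` sent to themselves. The fibres partition `V`
into stars centred in `A` (`isBiclique_starOf`). -/

/-- A finite subgraph whose edges are exactly the pairs separated by a predicate `p`, with both
sides nonempty, is a biclique. -/
theorem isBiclique_of_adj_iff [Finite V] {G : SimpleGraph V} (H : G.Subgraph) (p : V → Prop)
    (hadj : ∀ x ∈ H.verts, ∀ y ∈ H.verts, H.Adj x y ↔ (p x ∧ ¬ p y) ∨ (¬ p x ∧ p y))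
    {a b : V} (ha : a ∈ H.verts) (hpa : p a) (hb : b ∈ H.verts) (hpb : ¬ p b) :
    G.IsBiclique H := by
  classical
  let q : H.verts → Prop := fun x => p x
  have : Nonempty {x // q x} := ⟨⟨⟨a, ha⟩, hpa⟩⟩
  have : Nonempty {x // ¬ q x} := ⟨⟨⟨b, hb⟩, hpb⟩⟩
  let e : {x // q x} ⊕ {x // ¬ q x} ≃
      Fin (Nat.card {x // q x}) ⊕ Fin (Nat.card {x // ¬ q x}) :=
    Equiv.sumCongr (Finite.equivFin _) (Finite.equivFin _)
  refine Or.inl ⟨_, _, Nat.card_pos, Nat.card_pos, ⟨RelIso.symm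
    ⟨e.symm.trans (Equiv.sumCompl q), fun {x y} => ?_⟩⟩⟩
  obtain ⟨x, rfl⟩ := e.surjective x
  obtain ⟨y, rfl⟩ := e.surjective y
  rw [Subgraph.coe_adj, hadj _ (Subtype.prop _) _ (Subtype.prop _)]
  rcases x with ⟨x, hx⟩ | ⟨x, hx⟩ <;> rcases y with ⟨y, hy⟩ | ⟨y, hy⟩ <;>
    simp [e, show p x ↔ q x from Iff.rfl, show p y ↔ q y from Iff.rfl, hx, hy]

/-- The part of an independent set lying in a biclique is dominated by a single vertex. -/
theorem IsBiclique.exists_dominates {G : SimpleGraph V} {H : G.Subgraph} (hH : G.IsBiclique H)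
    {I : Set V} (hI : G.IsIndepSet I) :
    ∃ a, ∀ x ∈ I, x ∈ H.verts → x ∈ G.closedNbhd a := by
  rcases hH with ⟨p, q, hp, hq, ⟨e⟩⟩ | ⟨v, rfl⟩
  · have key : ∀ z x (hx : x ∈ H.verts),
        (completeBipartiteGraph (Fin p) (Fin q)).Adj z (e ⟨x, hx⟩) → G.Adj (e.symm z) x := fun z x hx h => by
      have h' : H.coe.Adj (e.symm z) ⟨x, hx⟩ := by
        rw [← e.map_adj_iff]; simpa using h
      exact H.adj_sub h'
    -- If `I` meets the left side, independence keeps it off the right side, so any right vertex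
    -- will do; otherwise any left vertex will.
    by_cases hl : ∃ i, ∃ hi : i ∈ H.verts, i ∈ I ∧ (e ⟨i, hi⟩).isLeft
    · obtain ⟨i, hi, hiI, hil⟩ := hl
      refine ⟨e.symm (Sum.inr ⟨0, hq⟩), fun x hxI hx => Or.inl (key _ _ hx ?_)⟩
      rcases hex : e ⟨x, hx⟩ with u | u
      · simp
      · have hadj : G.Adj i x := by
          simpa using key (e ⟨i, hi⟩) x hx (by simp [hex, hil])
        exact absurd hadj (hI hiI hxI hadj.ne)
    · refine ⟨e.symm (Sum.inl ⟨0, hp⟩), fun x hxI hx => Or.inl (key _ _ hx ?_)⟩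
      rcases hex : e ⟨x, hx⟩ with u | u
      · exact absurd ⟨x, hx, hxI, by simp [hex]⟩ hl
      · simp
  · exact ⟨v, fun x _ hx => Or.inr (by simpa using hx)⟩

theorem indepDomNumber_le_bicliquePartitionNumber [Finite V] (G : SimpleGraph V) :
    G.indepDomNumber ≤ G.bicliquePartitionNumber := by
  classical
  obtain ⟨I, hI, hIk⟩ := G.indepDomNumber_isGreatest.1
  obtain ⟨R, hR, hRk⟩ := G.bicliquePartitionNumber_isLeast.1
  rw [← hIk, ← hRk]
  choose c hc using fun H : R => (hR.1 H H.2).exists_dominates hI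
  refine ((G.domNumberOf_isLeast I).2 ⟨R.attach.image c, fun x hx => ?_, rfl⟩).trans
    (Finset.card_image_le.trans_eq R.card_attach)
  obtain ⟨H, ⟨hHR, hxH⟩, -⟩ := hR.2 x
  exact Set.mem_biUnion (Finset.mem_coe.2 (Finset.mem_image_of_mem c (R.mem_attach ⟨H, hHR⟩)))
    (hc ⟨H, hHR⟩ x hx hxH)

/-- The star centred at `a` formed by the vertices that `f` sends to `a`. -/
def starOf (G : SimpleGraph V) (f : V → V) (hf : ∀ v, f v = v ∨ G.Adj (f v) v) (a : V) :
    G.Subgraph where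
  verts := {v | f v = a}
  -- The exclusive form rules out a loop at `a` and fits `isBiclique_of_adj_iff` with the predicate
  -- `(· = a)`.
  Adj x y := f x = a ∧ f y = a ∧ ((x = a ∧ y ≠ a) ∨ (x ≠ a ∧ y = a))
  adj_sub := by
    rintro x y ⟨hx, hy, ⟨rfl, h⟩ | ⟨h, rfl⟩⟩
    · have := hf y
      rw [hy] at this
      exact this.resolve_left h.symm
    · have := hf x
      rw [hx] at this
      exact (this.resolve_left h.symm).symm
  edge_vert h := h.1
  symm := ⟨fun x y h => by tauto⟩

theorem isBiclique_starOf [Finite V] (G : SimpleGraph V) (f : V → V)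
    (hf : ∀ v, f v = v ∨ G.Adj (f v) v) {a : V} (ha : f a = a) :
    G.IsBiclique (G.starOf f hf a) := by
  by_cases hb : ∃ b, f b = a ∧ b ≠ a
  · obtain ⟨b, hb, hba⟩ := hb
    refine isBiclique_of_adj_iff _ (· = a) (fun x hx y hy => ?_) (a := a) (b := b) ha rfl hb hba
    exact ⟨fun h => h.2.2, fun h => ⟨hx, hy, h⟩⟩
  -- The fibre is `{a}`, which is the single-vertex biclique.
  · push Not at hb
    refine Or.inr ⟨a, Subgraph.ext ?_ ?_⟩
    · ext x
      exact ⟨hb x, fun h => (show x = a from h) ▸ ha⟩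
    · ext x y
      refine ⟨fun ⟨hx, hy, h⟩ => ?_, fun h => h.elim⟩
      have := hb x hx
      have := hb y hy
      tauto

theorem bicliquePartitionNumber_le_domNumber [Finite V] (G : SimpleGraph V) :
    G.bicliquePartitionNumber ≤ G.domNumber := by
  classical
  obtain ⟨A, hA, hAk⟩ := (G.domNumberOf_isLeast Set.univ).1
  rw [domNumber, ← hAk]
  -- The last clause puts each `a ∈ A` in its own fibre, so that every star contains its centre.
  have hex : ∀ v, ∃ a ∈ A, (a = v ∨ G.Adj a v) ∧ (v ∈ A → a = v) := fun v => by
    by_cases hv : v ∈ A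
    · exact ⟨v, hv, Or.inl rfl, fun _ => rfl⟩
    · obtain ⟨a, ha, hva⟩ := Set.mem_iUnion₂.1 (hA (Set.mem_univ v))
      refine ⟨a, ha, ?_, fun h => absurd h hv⟩
      rcases hva with h | h
      · exact Or.inr h
      · exact Or.inl (Eq.symm h)
  choose f hfA hf hfix using hex
  refine (G.bicliquePartitionNumber_isLeast.2
    ⟨A.image (G.starOf f hf), ⟨fun H hH => ?_, fun v => ?_⟩, rfl⟩).trans Finset.card_image_le
  · obtain ⟨a, ha, rfl⟩ := Finset.mem_image.1 hH
    exact G.isBiclique_starOf f hf (hfix a ha)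
  · refine ⟨G.starOf f hf (f v), ⟨Finset.mem_image_of_mem _ (hfA v), rfl⟩, ?_⟩
    rintro H ⟨hH, hv⟩
    obtain ⟨a, -, rfl⟩ := Finset.mem_image.1 hH
    rw [show f v = a from hv]

end SimpleGraph

theorem corollary1p2 {V : Type*} [Finite V] (G : SimpleGraph V) :
    G.indepDomNumber ≤ G.bicliquePartitionNumber ∧
      G.bicliquePartitionNumber ≤ G.domNumber :=
  ⟨G.indepDomNumber_le_bicliquePartitionNumber, G.bicliquePartitionNumber_le_domNumber⟩
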